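/- **Conventions.** Letters come from a countably infinite alphabet; words are finite sequences of letters, and $\lambda$ is the empty word. A monoid satisfies an identity $\mathbf u\approx\mathbf v$ if both sides are equal under every assignment of its elements to the letters; $\operatorname{var}\Sigma$ is the class of all monoids satisfying all identities in $\Sigma$; an identity holds in a class if all monoids of the class satisfy it; it is non-trivial if $\mathbf u\neq\mathbf v$ as words. Let $$\Phi=\{xyx\approx xyx^2,\ x^2y^2\approx y^2x^2,\ x^2y\approx x^2yx\},\qquad \mathbf K=\operatorname{var}\Phi,$$ and, for every integer $k\ge 1$, let $\mathbf F_k=\operatorname{var}(\Phi\cup\{\alpha_k\})$, where $$\alpha_k:\ x_ky_kx_{k-1}x_ky_k\mathbf b_{k-1}\approx y_kx_kx_{k-1}x_ky_k\mathbf b_{k-1},\qquad \mathbf b_0=\lambda,\quad \mathbf b_s=x_{s-1}x_s\,x_{s-2}x_{s-1}\cdots x_0x_1 .$$ For a word $\mathbf w$ let $\operatorname{con}(\mathbf w)$, $\operatorname{sim}(\mathbf w)$ and $\operatorname{mul}(\mathbf w)$ be the sets of letters that occur in $\mathbf w$ at least once, exactly once, and at least twice, respectively. The $k$-decomposition $\mathbf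 w=t_0\mathbf w_0t_1\mathbf w_1\cdots t_m\mathbf w_m$ of $\mathbf w$ into $k$-dividers $t_0=\lambda,t_1,\dots,t_m$ (where $t_1,\dots,t_m$ are letters) and possibly empty $k$-blocks $\mathbf w_0,\dots,\mathbf w_m$ is defined by induction on $k\ge 0$: for $k=0$, the letters $t_1,\dots,t_m$ are the simple letters of $\mathbf w$ in the order of their occurrence; the $(k+1)$-decomposition is obtained from the $k$-decomposition by turning into dividers, in each $k$-block $\mathbf w_i$, all letters that occur exactly once in $\mathbf w_i$ and do not occur in $\mathbf w$ to the left of $\mathbf w_i$. For a letter $x$ and $1\le i\le$ the number of occurrences of $x$ in $\mathbf w$, the restrictor $h_i^k(\mathbf w,x)$ is the right-most $k$-divider of $\mathbf w$ that strictly precedes the $i$-th occurrence of $x$ in $\mathbf w$ (it may be $t_0=\lambda$). **Proposition.** For words $\mathbf u,\mathbf v$ consider the conditions (A) $\operatorname{sim}(\mathbf u)=\operatorname{sim}(\mathbf v)$ and $\operatorname{mul}(\mathbf u)=\operatorname{mul}(\mathbf v)$; (B$_\ell$) $h_i^{\ell-1}(\mathbf u,x)=h_i^{\ell-1}(\mathbf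 v,x)$ for $i=1,2$ and all $x\in\operatorname{con}(\mathbf u)$, where the equality for $i$ is required only if $x$ occurs at least $i$ times in both words. Let $\mathbf u\approx\mathbf v$ be a non-trivial identity. (i) For every $k\ge 1$, the identity $\mathbf u\approx\mathbf v$ holds in $\mathbf F_k$ if and only if (A) and (B$_k$) are true. (ii) The identity $\mathbf u\approx\mathbf v$ holds in $\mathbf K$ if and only if (A) and (B$_\ell$) for all $\ell\ge 1$ are true. -/

import Mathlib

namespace MonoidWords

/-! ### Words, identities, varieties of monoids -/

/-- The countably infinite alphabet. -/
abbrev Letter : Type := ℕ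

/-- Possibly empty words; the empty word is `1`. -/
abbrev Word : Type := FreeMonoid Letter

/-- An identity `u ≈ v`, given by the pair `(u, v)`. -/
abbrev Identity : Type := Word × Word

/-- The monoid `M` satisfies `u ≈ v`: both sides take the same value under every assignment of
elements of `M` to the letters. -/
def Satisfies (M : Type*) [Monoid M] (e : Identity) : Prop :=
  ∀ φ : Letter → M, FreeMonoid.lift φ e.1 = FreeMonoid.lift φ e.2

/-- The variety (class of monoids) given by a system of identities. -/
def var.{w} (S : Set Identity) : Set MonCat.{w} :=
  {M | ∀ e ∈ S, Satisfies M e}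

/-- The identity `e` holds in the class `V` of monoids. -/
def HoldsIn.{w} (V : Set MonCat.{w}) (e : Identity) : Prop :=
  ∀ M ∈ V, Satisfies M e

/-! ### The varieties `K` and `F k` -/

/-- The letters `x₀, x₁, …`. -/
def x (i : ℕ) : Word := FreeMonoid.of (2 * i)

/-- The letters `y₀, y₁, …`, distinct from the `xᵢ`. -/
def y (i : ℕ) : Word := FreeMonoid.of (2 * i + 1)

/-- The system `xyx ≈ xyx²`, `x²y² ≈ y²x²`, `x²y ≈ x²yx`, written with `x = x₀`, `y = y₀`. -/
def Phi : Set Identity :=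
  {(x 0 * y 0 * x 0, x 0 * y 0 * x 0 ^ 2),
   (x 0 ^ 2 * y 0 ^ 2, y 0 ^ 2 * x 0 ^ 2),
   (x 0 ^ 2 * y 0, x 0 ^ 2 * y 0 * x 0)}

/-- `b s = x_{s-1} x_s x_{s-2} x_{s-1} ⋯ x_0 x_1`, and `b 0` is empty. -/
def b : ℕ → Word
  | 0 => 1
  | s + 1 => x s * x (s + 1) * b s

/-- The identity `x_k y_k x_{k-1} x_k y_k b_{k-1} ≈ y_k x_k x_{k-1} x_k y_k b_{k-1}`, for `1 ≤ k`. -/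
def alpha (k : ℕ) : Identity :=
  (x k * y k * x (k - 1) * x k * y k * b (k - 1),
   y k * x k * x (k - 1) * x k * y k * b (k - 1))

/-- The variety `K`. -/
def K.{w} : Set MonCat.{w} := var Phi

/-- The variety `F_k`, for `1 ≤ k`. -/
def F.{w} (k : ℕ) : Set MonCat.{w} := var (Phi ∪ {alpha k})

/-! ### Occurrences, decompositions and restrictors -/

/-- The number of occurrences of the letter `a` in `w`. -/
def occ (a : Letter) (w : Word) : ℕ := w.toList.count a

/-- The content: the set of letters occurring in `w`. -/
def con (w : Word) : Set Letter := {a | 1 ≤ occ a w}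

/-- The set of simple letters of `w`. -/
def sim (w : Word) : Set Letter := {a | occ a w = 1}

/-- The set of multiple letters of `w`. -/
def mul (w : Word) : Set Letter := {a | 2 ≤ occ a w}

/-- A list `[(t₀, w₀), (t₁, w₁), …, (t_m, w_m)]` standing for the factorization
`t₀ w₀ t₁ w₁ ⋯ t_m w_m` of a word into alternating dividers `tᵢ` and blocks `wᵢ`.
The divider `none` is the empty word. -/
abbrev Decomposition : Type := List (Option Letter × List Letter)

/-- `split p t c w` factorizes the word `t · c · w`, where `t` is already known to be a divider and
`c` is the part already read of the block that follows `t`: the new dividers are exactly the letters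
of `w` that satisfy `p`. -/
def split (p : Letter → Bool) : Option Letter → List Letter → List Letter → Decomposition
  | t, c, [] => [(t, c)]
  | t, c, a :: w => if p a then (t, c) :: split p (some a) [] w else split p t (c ++ [a]) w

/-- One refinement step. In every block `c`, the letters that are simple in `c` and do not occur in
the whole word to the left of `c` become dividers. The argument `l` is the part of the whole word
to the left of the listed factors. -/
def refine : List Letter → Decomposition → Decomposition
  | _, [] => []
  | l, (t, c) :: d =>
      split (fun a => c.count a = 1 ∧ a ∉ l ++ t.toList) t [] c ++ refine (l ++ t.toList ++ c) d

/-- The `k`-decomposition of `w`. -/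
def decomposition (w : Word) : ℕ → Decomposition
  | 0 => split (fun a => occ a w = 1) none [] w.toList
  | k + 1 => refine [] (decomposition w k)

/-- The word given by a factorization, letter by letter, each nonempty divider marked by `true`
and each letter inside a block marked by `false`. -/
def marked (d : Decomposition) : List (Letter × Bool) :=
  d.flatMap fun tc => tc.1.toList.map (fun a => (a, true)) ++ tc.2.map (fun a => (a, false))

/-- The part of a marked word strictly to the left of the `i`-th occurrence of the letter `a`
(counted from `1`). -/
def before (a : Letter) : ℕ → List (Letter × Bool) → List (Letter × Bool)
  | _, [] => []
  | i, c :: s =>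
      if c.1 = a then (if i = 1 then [] else c :: before a (i - 1) s) else c :: before a i s

/-- The `(i, k)`-restrictor `h_i^k(w, a)`: the right-most `k`-divider of `w` that precedes the
`i`-th occurrence of `a`; it is `none` if this is the empty divider `t₀`.
Meaningful for `1 ≤ i ≤ occ a w`. -/
def restrictor (i k : ℕ) (w : Word) (a : Letter) : Option Letter :=
  (((before a i (marked (decomposition w k))).filter fun c => c.2).getLast?).map fun c => c.1

/-- `u` and `v` have the same simple letters and the same multiple letters. -/
def SameSimpMul (u v : Word) : Prop := sim u = sim v ∧ mul u = mul v

/-- `h_i^k(u, a) = h_i^k(v, a)` for `i = 1, 2` and all letters `a` of `u`, where the equality for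
`i` is required only if the `i`-th occurrence of `a` exists in both words. -/
def SameRestrictors (k : ℕ) (u v : Word) : Prop :=
  ∀ a ∈ con u, ∀ i : ℕ, (i = 1 ∨ i = 2) → i ≤ occ a u → i ≤ occ a v →
    restrictor i k u a = restrictor i k v a

end MonoidWords

universe w

/-! An identity holds in the variety given by `S` iff it is a consequence of `S`, so the theorem
describes two fully invariant congruences on words. Call the restrictors of the first two
occurrences of all letters, computed with respect to a set `D` of letters whose first occurrences
are the dividers, the profile of a word. A letter divides at the next level iff its first two
restrictors differ; hence the profile at one level determines the dividers of the next level, and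
words with equal profiles have the same dividers at all coarser levels.

The profile does not change when letters that have already occurred twice are inserted, or when two
adjacent factors that together meet no divider are swapped. Conversely, two words with equal
profiles are connected by such steps: delete all third and later occurrences, then sort one word
into the other from left to right.

`Φ` yields all the insertions. If `z z'` lies in a `(k - 1)`-block, reading on to the ends of the
blocks of levels `k - 2, …, 0` and then to the end of the word yields words to substitute for
`x_{k-1}, …, x_0` so that `α_k` swaps `z` and `z'`. Conversely, both sides of every substitution
instance of `Φ` and `α_k`, in any context, are connected by steps at level `k - 1`. For `Φ` alone,
the dividers of a word stabilize at some level; then every letter of a block has occurred twice by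
the end of the block, so the contents of the block can be squared, and squares commute.
-/

namespace MonoidWords

/-! ### Dividers and restrictors -/

section Words

variable {α : Type*} {D E E' : Set α} {p q r c z z' u v : List α} {a : α}

/-- Reading the factor `z` after the left context `p` meets no divider, where the dividers are the
first occurrences of the letters of `D`. -/
def Undivided (D : Set α) (p z : List α) : Prop := ∀ a ∈ z, a ∈ D → a ∈ p

theorem Undivided.anti (h : Undivided E p z) (hDE : D ⊆ E) : Undivided D p z :=
  fun a ha haD => h a ha (hDE haD)

theorem Undivided.of_subset (h : Undivided D p z) (hz : z' ⊆ z) : Undivided D p z' :=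
  fun a ha => h a (hz ha)

theorem undivided_append : Undivided D p (z ++ z') ↔ Undivided D p z ∧ Undivided D (p ++ z) z' := by
  simp only [Undivided, List.mem_append]
  grind

theorem not_undivided_singleton : ¬ Undivided D p [a] ↔ a ∈ D ∧ a ∉ p := by
  simp [Undivided]

/-- The factor `c` is a whole block, up to its right end, of `p ++ c ++ r`: it meets no divider and
either a divider or nothing follows it. -/
def IsBlock (D : Set α) (p c r : List α) : Prop :=
  Undivided D p c ∧ ∀ b ∈ r.head?, b ∈ D ∧ b ∉ p ++ c

theorem exists_isBlock (D : Set α) (p q : List α) : ∃ c r, q = c ++ r ∧ IsBlock D p c r := by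
  induction q generalizing p with
  | nil => exact ⟨[], [], rfl, by simp [IsBlock, Undivided]⟩
  | cons b q ih =>
    by_cases hb : Undivided D p [b]
    · obtain ⟨c, r, rfl, hc, hr⟩ := ih (p ++ [b])
      exact ⟨b :: c, r, rfl, (undivided_append (z := [b])).2 ⟨hb, hc⟩, by simpa using hr⟩
    · exact ⟨[], b :: q, rfl, by simp [Undivided], by simpa using not_undivided_singleton.1 hb⟩

theorem IsBlock.append_left (hz : Undivided D p z) (h : IsBlock D (p ++ z) c r) :
    IsBlock D p (z ++ c) r :=
  ⟨undivided_append.2 ⟨hz, h.1⟩, by simpa only [List.append_assoc] using h.2⟩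

variable [DecidableEq α]

open Classical in
/-- The right-most divider of `p`, where the dividers are the first occurrences of the letters of
`D`; it is `none` if there is no divider. -/
noncomputable def lastDivider (D : Set α) (p : List α) : Option α :=
  p.reverse.dedup.find? (· ∈ D)

theorem lastDivider_concat_of_divides (ha : a ∉ p) (haD : a ∈ D) :
    lastDivider D (p ++ [a]) = some a := by
  simp [lastDivider, List.dedup_cons_of_notMem, ha, haD]

theorem lastDivider_concat_of_undivided (h : Undivided D p [a]) :
    lastDivider D (p ++ [a]) = lastDivider D p := by
  by_cases ha : a ∈ p
  · simp [lastDivider, List.dedup_cons_of_mem, ha]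
  · have haD : a ∉ D := fun haD => ha (h a (List.mem_singleton_self a) haD)
    simp [lastDivider, List.dedup_cons_of_notMem, ha, haD]

theorem lastDivider_append_of_undivided (h : Undivided D p z) :
    lastDivider D (p ++ z) = lastDivider D p := by
  induction z using List.reverseRecOn with
  | nil => rw [List.append_nil]
  | append_singleton z a ih =>
    rw [undivided_append] at h
    rw [← List.append_assoc, lastDivider_concat_of_undivided h.2, ih h.1]

theorem mem_of_lastDivider_eq_some (h : lastDivider D p = some a) : a ∈ p :=
  List.mem_reverse.1 (List.mem_dedup.1 (List.mem_of_find?_eq_some h))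

theorem lastDivider_eq_none_iff : lastDivider D p = none ↔ Undivided D [] p := by
  simp [lastDivider, Undivided]

theorem exists_append_of_lastDivider_eq_some (h : lastDivider D p = some a) :
    ∃ r t, p = r ++ [a] ++ t ∧ a ∉ r ∧ a ∈ D ∧ Undivided D (r ++ [a]) t := by
  induction p using List.reverseRecOn with
  | nil => simp [lastDivider] at h
  | append_singleton p b ih =>
    by_cases hb : Undivided D p [b]
    · obtain ⟨r, t, rfl, har, haD, ht⟩ := ih (lastDivider_concat_of_undivided hb ▸ h)
      exact ⟨r, t ++ [b], by simp, har, haD, undivided_append.2 ⟨ht, hb⟩⟩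
    · obtain ⟨hbD, hbp⟩ := not_undivided_singleton.1 hb
      obtain rfl : b = a := by simpa [lastDivider_concat_of_divides hbp hbD] using h
      exact ⟨p, [], by simp, hbp, hbD, by simp [Undivided]⟩

theorem exists_lastDivider_append_eq_some (h : ¬ Undivided D p z) :
    ∃ s, s ∉ p ∧ lastDivider D (p ++ z) = some s := by
  induction z using List.reverseRecOn with
  | nil => simp [Undivided] at h
  | append_singleton z b ih =>
    rw [← List.append_assoc]
    by_cases hb : Undivided D (p ++ z) [b]
    · rw [lastDivider_concat_of_undivided hb]
      exact ih fun hz => h (undivided_append.2 ⟨hz, hb⟩)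
    · obtain ⟨hbD, hbp⟩ := not_undivided_singleton.1 hb
      exact ⟨b, fun hb' => hbp (List.mem_append_left z hb'), lastDivider_concat_of_divides hbp hbD⟩

theorem lastDivider_append_eq_iff : lastDivider D (p ++ z) = lastDivider D p ↔ Undivided D p z := by
  refine ⟨fun h => ?_, lastDivider_append_of_undivided⟩
  by_contra hz
  obtain ⟨s, hs, hz⟩ := exists_lastDivider_append_eq_some hz
  exact hs (mem_of_lastDivider_eq_some (h.symm.trans hz))

theorem lastDivider_append_congr (h : lastDivider D p = lastDivider D q)
    (hpq : ∀ a, a ∈ p ↔ a ∈ q) : lastDivider D (p ++ z) = lastDivider D (q ++ z) := by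
  induction z using List.reverseRecOn with
  | nil => simpa using h
  | append_singleton z a ih =>
    have hmem : a ∈ p ++ z ↔ a ∈ q ++ z := by simp only [List.mem_append, hpq]
    by_cases ha : Undivided D (p ++ z) [a]
    · have ha' : Undivided D (q ++ z) [a] := by simpa only [Undivided, List.mem_singleton,
        forall_eq, hmem] using ha
      rw [← List.append_assoc, ← List.append_assoc, lastDivider_concat_of_undivided ha,
        lastDivider_concat_of_undivided ha', ih]
    · obtain ⟨haD, hap⟩ := not_undivided_singleton.1 ha
      rw [← List.append_assoc, ← List.append_assoc, lastDivider_concat_of_divides hap haD,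
        lastDivider_concat_of_divides (fun h => hap (hmem.2 h)) haD]

theorem exists_append_of_lt_count {i : ℕ} (h : i < u.count a) :
    ∃ p q, u = p ++ a :: q ∧ p.count a = i := by
  induction u generalizing i with
  | nil => simp at h
  | cons b u ih =>
    by_cases hba : b = a
    · subst hba
      cases i with
      | zero => exact ⟨[], u, rfl, rfl⟩
      | succ i =>
        obtain ⟨p, q, rfl, hp⟩ := ih (by simpa using h)
        exact ⟨b :: p, q, rfl, by simpa using hp⟩
    · obtain ⟨p, q, rfl, hp⟩ := ih (by simpa [List.count_cons_of_ne hba] using h)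
      exact ⟨b :: p, q, rfl, by simpa [List.count_cons_of_ne hba] using hp⟩

theorem eq_of_append_cons_eq_append_cons {p' q' : List α} (h : p ++ a :: q = p' ++ a :: q')
    (hcount : p.count a = p'.count a) : p = p' := by
  obtain ⟨c, rfl, hc⟩ | ⟨c, rfl, hc⟩ := List.append_eq_append_iff.1 h <;>
  · obtain _ | ⟨b, c⟩ := c
    · simp
    · simp_all

/-- The restrictors of the first two occurrences of every letter of `w`, for the dividers that are
the first occurrences of the letters of `D`: the triple `(a, i, c)` says that `c` is the last
divider before the occurrence of `a` that is preceded by `i` occurrences of `a`. -/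
def profile (D : Set α) (w : List α) : Set (α × ℕ × Option α) :=
  {t | t.2.1 ≤ 1 ∧ ∃ p q, w = p ++ t.1 :: q ∧ p.count t.1 = t.2.1 ∧ lastDivider D p = t.2.2}

theorem mem_profile {i : ℕ} {c : Option α} : (a, i, c) ∈ profile D u ↔
    i ≤ 1 ∧ ∃ p q, u = p ++ a :: q ∧ p.count a = i ∧ lastDivider D p = c := Iff.rfl

theorem mem_profile_append_cons (h : p.count a ≤ 1) :
    (a, p.count a, lastDivider D p) ∈ profile D (p ++ a :: q) :=
  ⟨h, p, q, rfl, rfl, rfl⟩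

theorem lt_count_of_mem_profile {i : ℕ} {c : Option α} (h : (a, i, c) ∈ profile D u) :
    i < u.count a := by
  obtain ⟨-, p, q, rfl, rfl, -⟩ := mem_profile.1 h
  simp

theorem lt_count_of_profile_eq (h : profile D u = profile E v) {i : ℕ} (hi : i ≤ 1)
    (hu : i < u.count a) : i < v.count a := by
  obtain ⟨p, q, rfl, rfl⟩ := exists_append_of_lt_count hu
  exact lt_count_of_mem_profile (h ▸ mem_profile_append_cons hi)

theorem min_count_eq_of_profile_eq (h : profile D u = profile E v) (a : α) :
    min 2 (u.count a) = min 2 (v.count a) := by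
  have h0 := lt_count_of_profile_eq (a := a) h zero_le_one
  have h1 := lt_count_of_profile_eq (a := a) h le_rfl
  have h0' := lt_count_of_profile_eq (a := a) h.symm zero_le_one
  have h1' := lt_count_of_profile_eq (a := a) h.symm le_rfl
  omega

theorem lastDivider_eq_of_profile_eq {p' q' : List α}
    (h : profile D (p ++ a :: q) = profile E (p' ++ a :: q')) (hcount : p.count a = p'.count a)
    (hp : p.count a ≤ 1) : lastDivider D p = lastDivider E p' := by
  obtain ⟨-, r, s, hr, hrp, hc⟩ := mem_profile.1 (h ▸ mem_profile_append_cons (D := D) (q := q) hp)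
  rw [← hc, eq_of_append_cons_eq_append_cons hr (hcount.symm.trans hrp.symm)]

theorem profile_subset_profile (hmin : ∀ a, min 2 (u.count a) ≤ v.count a)
    (hlast : ∀ a p q p' q', u = p ++ a :: q → v = p' ++ a :: q' → p.count a = p'.count a →
      p.count a ≤ 1 → lastDivider D p = lastDivider E p') : profile D u ⊆ profile E v := by
  rintro ⟨a, i, c⟩ h
  obtain ⟨hi, p, q, rfl, rfl, rfl⟩ := mem_profile.1 h
  have hcount := hmin a
  rw [List.count_append, List.count_cons_self] at hcount
  obtain ⟨p', q', rfl, hp⟩ := exists_append_of_lt_count (show p.count a < v.count a by omega)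
  exact mem_profile.2 ⟨hi, p', q', rfl, hp, (hlast a p q p' q' rfl rfl hp.symm hi).symm⟩

theorem profile_eq_iff : profile D u = profile E v ↔
    (∀ a, min 2 (u.count a) = min 2 (v.count a)) ∧ ∀ a p q p' q', u = p ++ a :: q →
      v = p' ++ a :: q' → p.count a = p'.count a → p.count a ≤ 1 →
        lastDivider D p = lastDivider E p' := by
  constructor
  · refine fun h => ⟨min_count_eq_of_profile_eq h, ?_⟩
    rintro a p q p' q' rfl rfl hcount hp
    exact lastDivider_eq_of_profile_eq h hcount hp
  · rintro ⟨hmin, hlast⟩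
    refine (profile_subset_profile (fun a => hmin a ▸ min_le_right _ _) hlast).antisymm
      (profile_subset_profile (fun a => (hmin a).symm ▸ min_le_right _ _) ?_)
    exact fun a p q p' q' hv hu hcount hp =>
      (hlast a p' q' p q hu hv hcount.symm (hcount ▸ hp)).symm

theorem undivided_of_profile_eq {w w' : List α}
    (h : profile D (p ++ a :: w) = profile D (p ++ z ++ a :: w')) (haz : a ∉ z)
    (hp : p.count a ≤ 1) : Undivided D p z := by
  refine lastDivider_append_eq_iff.1 (lastDivider_eq_of_profile_eq h ?_ hp).symm
  rw [List.count_append, List.count_eq_zero.2 haz, add_zero]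

theorem mem_profile_append {i : ℕ} {c : Option α} : (a, i, c) ∈ profile D (u ++ v) ↔
    (a, i, c) ∈ profile D u ∨
      i ≤ 1 ∧ ∃ p q, v = p ++ a :: q ∧ (u ++ p).count a = i ∧ lastDivider D (u ++ p) = c := by
  constructor
  · rintro ⟨hi, p, q, huv, hp, hc⟩
    obtain ⟨r, rfl, rfl⟩ | ⟨r, rfl, hr⟩ := List.append_eq_append_iff.1 huv
    · exact Or.inr ⟨hi, r, q, rfl, hp, hc⟩
    · obtain _ | ⟨b, r⟩ := r
      · exact Or.inr ⟨hi, [], q, hr.symm, by simpa using hp, by simpa using hc⟩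
      · obtain ⟨rfl, rfl⟩ := List.cons_eq_cons.1 hr
        exact Or.inl ⟨hi, p, r, rfl, hp, hc⟩
  · rintro (⟨hi, p, q, rfl, hp, hc⟩ | ⟨hi, p, q, rfl, hp, hc⟩)
    · exact ⟨hi, p, q ++ v, by simp, hp, hc⟩
    · exact ⟨hi, u ++ p, q, by simp, hp, hc⟩

theorem mem_profile_append_of_undivided (hz : Undivided D p z) {i : ℕ} {c : Option α} :
    (a, i, c) ∈ profile D (p ++ z) ↔ (a, i, c) ∈ profile D p ∨
      i ≤ 1 ∧ p.count a ≤ i ∧ i < (p ++ z).count a ∧ lastDivider D p = c := by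
  rw [mem_profile_append]
  refine or_congr_right (and_congr_right fun _ => ⟨?_, ?_⟩)
  · rintro ⟨r, s, rfl, rfl, rfl⟩
    have hr : Undivided D p r := hz.of_subset (List.subset_append_left r _)
    exact ⟨by simp, by simp, (lastDivider_append_of_undivided hr).symm⟩
  · rintro ⟨hle, hlt, rfl⟩
    obtain ⟨r, s, rfl, hr⟩ := exists_append_of_lt_count
      (show i - p.count a < z.count a by rw [List.count_append] at hlt; omega)
    have hr' : Undivided D p r := hz.of_subset (List.subset_append_left r _)
    exact ⟨r, s, rfl, by rw [List.count_append]; omega, lastDivider_append_of_undivided hr'⟩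

theorem profile_append_congr (h : profile D u = profile D v)
    (hlast : lastDivider D u = lastDivider D v) :
    profile D (u ++ q) = profile D (v ++ q) := by
  have hcount := min_count_eq_of_profile_eq h
  have hmem : ∀ a, a ∈ u ↔ a ∈ v := fun a => by
    have := hcount a
    rw [← List.count_pos_iff, ← List.count_pos_iff]
    omega
  ext ⟨a, i, c⟩
  rw [mem_profile_append, mem_profile_append, h]
  refine or_congr_right (and_congr_right fun hi => exists_congr fun p => exists_congr fun s =>
    and_congr_right fun _ => ?_)
  rw [lastDivider_append_congr hlast hmem, List.count_append, List.count_append]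
  have := hcount a
  exact and_congr_left fun _ => by omega

theorem profile_append_append_congr (hz : Undivided D p z) (hz' : Undivided D p z')
    (hcount : ∀ a, min 2 ((p ++ z).count a) = min 2 ((p ++ z').count a)) :
    profile D (p ++ z ++ q) = profile D (p ++ z' ++ q) := by
  refine profile_append_congr ?_ ?_
  · ext ⟨a, i, c⟩
    rw [mem_profile_append_of_undivided hz, mem_profile_append_of_undivided hz']
    have := hcount a
    refine or_congr_right (and_congr_right fun hi => and_congr_right fun _ => ?_)
    exact and_congr_left fun _ => by omega
  · rw [lastDivider_append_of_undivided hz, lastDivider_append_of_undivided hz']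

theorem lastDivider_eq_of_profile_eq_of_subset {p' q' : List α}
    (h : profile E (p ++ q) = profile E' (p' ++ q')) (hE : D ⊆ E) (hE' : D ⊆ E')
    (hlast : lastDivider E p = lastDivider E' p') : lastDivider D p = lastDivider D p' := by
  induction hn : p.length using Nat.strong_induction_on generalizing p q p' q' with
  | _ n ih =>
  subst hn
  cases hs : lastDivider E p with
  | none =>
    rw [lastDivider_eq_none_iff.2 ((lastDivider_eq_none_iff.1 hs).anti hE),
      lastDivider_eq_none_iff.2 ((lastDivider_eq_none_iff.1 (hlast.symm.trans hs)).anti hE')]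
  | some s =>
    obtain ⟨r, t, rfl, hsr, -, ht⟩ := exists_append_of_lastDivider_eq_some hs
    obtain ⟨r', t', rfl, hsr', -, ht'⟩ :=
      exists_append_of_lastDivider_eq_some (hlast.symm.trans hs)
    rw [lastDivider_append_of_undivided (ht.anti hE),
      lastDivider_append_of_undivided (ht'.anti hE')]
    by_cases hsD : s ∈ D
    · rw [lastDivider_concat_of_divides hsr hsD, lastDivider_concat_of_divides hsr' hsD]
    · have hnot : ∀ l, Undivided D l [s] := fun l b hb hbD =>
        absurd (List.mem_singleton.1 hb ▸ hbD) hsD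
      rw [lastDivider_concat_of_undivided (hnot r), lastDivider_concat_of_undivided (hnot r')]
      simp only [List.append_assoc, List.singleton_append] at h
      refine ih r.length (by simp) h (lastDivider_eq_of_profile_eq h ?_ ?_) rfl
      · rw [List.count_eq_zero.2 hsr, List.count_eq_zero.2 hsr']
      · simp [List.count_eq_zero.2 hsr]

theorem profile_eq_of_subset (h : profile E u = profile E' v) (hE : D ⊆ E) (hE' : D ⊆ E') :
    profile D u = profile D v := by
  have key : ∀ {E E' u v}, D ⊆ E → D ⊆ E' → profile E u = profile E' v →
      profile D u ⊆ profile D v := by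
    rintro E E' u v hE hE' h ⟨a, i, c⟩ hmem
    obtain ⟨hi, p, q, rfl, rfl, rfl⟩ := mem_profile.1 hmem
    obtain ⟨-, p', q', rfl, hp', hlast⟩ :=
      mem_profile.1 (h ▸ mem_profile_append_cons (D := E) (q := q) hi)
    exact ⟨hi, p', q', rfl, hp', (lastDivider_eq_of_profile_eq_of_subset h hE hE' hlast.symm).symm⟩
  exact (key hE hE' h).antisymm (key hE' hE h.symm)

/-- The dividers of the next decomposition of `w` if those of the current one are the first
occurrences of the letters of `D`: the letters of `D`, together with those that occur exactly once
in the block that contains their first occurrence. -/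
def refineDividers (w : List α) (D : Set α) : Set α :=
  {a | a ∈ w ∧ ∀ p z r, w = p ++ z ++ r → Undivided D p z → a ∉ p → z.count a ≤ 1}

theorem Undivided.notMem_refineDividers (hz : Undivided D p z) (hap : a ∉ p)
    (ha : 2 ≤ z.count a) : a ∉ refineDividers (p ++ z ++ q) D := fun h => by
  have := h.2 p z q rfl hz hap
  omega

theorem refineDividers_mono (w : List α) : Monotone (refineDividers w) :=
  fun _ _ hDE _ ha => ⟨ha.1, fun p z r hw hz => ha.2 p z r hw (hz.anti hDE)⟩

/-- A letter is a divider of the next decomposition iff its first two restrictors differ. -/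
theorem mem_refineDividers_iff {w : List α} : a ∈ refineDividers w D ↔
    a ∈ w ∧ ∀ c, (a, 0, c) ∈ profile D w → (a, 1, c) ∉ profile D w := by
  refine and_congr_right fun _ => ⟨?_, ?_⟩
  · rintro h c ⟨-, p, q, rfl, hp, rfl⟩ h1
    obtain ⟨-, p', q', hw, hp', hlast⟩ := mem_profile.1 h1
    replace hp : p.count a = 0 := hp
    obtain ⟨r, rfl, hr⟩ | ⟨r, rfl, hr⟩ := List.append_eq_append_iff.1 hw
    · obtain _ | ⟨b, r⟩ := r
      · simp [hp] at hp'
      · obtain ⟨rfl, rfl⟩ := List.cons_eq_cons.1 hr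
        have hund : Undivided D p (a :: (r ++ [a])) := by
          rw [← List.cons_append, undivided_append]
          exact ⟨lastDivider_append_eq_iff.1 hlast, by simp [Undivided]⟩
        have := h p (a :: (r ++ [a])) q' (by simp) hund (List.count_eq_zero.1 hp)
        simp at this
    · rw [List.count_append] at hp
      omega
  · rintro h p z r rfl hz hap
    by_contra! hcount
    have hcount' : (p ++ z).count a = z.count a := by
      rw [List.count_append, List.count_eq_zero.2 hap, zero_add]
    refine h (lastDivider D p) ?_ ?_ <;>
    · refine mem_profile_append.2 (Or.inl ((mem_profile_append_of_undivided hz).2 (Or.inr ?_)))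
      exact ⟨by omega, by simp [List.count_eq_zero.2 hap], by omega, rfl⟩

theorem refineDividers_eq_of_profile_eq (h : profile D u = profile D v) :
    refineDividers u D = refineDividers v D := by
  ext a
  rw [mem_refineDividers_iff, mem_refineDividers_iff, h, ← List.count_pos_iff,
    ← List.count_pos_iff]
  exact and_congr_left' ⟨lt_count_of_profile_eq h zero_le_one,
    lt_count_of_profile_eq h.symm zero_le_one⟩

/-- The nonempty `k`-dividers of a word `w` are the first occurrences of the letters of
`dividers w (k + 1)`. The shift makes the `0`-decomposition the refinement of a decomposition with
the single block `w`. -/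
def dividers (w : List α) (n : ℕ) : Set α := (refineDividers w)^[n] ∅

theorem dividers_succ (w : List α) (n : ℕ) :
    dividers w (n + 1) = refineDividers w (dividers w n) :=
  Function.iterate_succ_apply' _ _ _

theorem dividers_mono (w : List α) : Monotone (dividers w) := fun _ _ hmn =>
  (refineDividers_mono w).monotone_iterate_of_le_map (Set.empty_subset _) hmn

theorem dividers_succ_eq_of_profile_eq {n : ℕ} (h : profile D u = profile E v)
    (hn : dividers u n = dividers v n) (hD : dividers u n ⊆ D) (hE : dividers v n ⊆ E) :
    dividers u (n + 1) = dividers v (n + 1) := by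
  rw [dividers_succ, dividers_succ, ← hn]
  exact refineDividers_eq_of_profile_eq (profile_eq_of_subset h hD (hn ▸ hE))

theorem dividers_eq_of_profile_eq {n : ℕ} (h : profile D u = profile D v)
    (hD : dividers u n ⊆ D) : dividers u (n + 1) = dividers v (n + 1) := by
  induction n with
  | zero => exact dividers_succ_eq_of_profile_eq h rfl hD hD
  | succ n ih =>
    have hn := ih ((dividers_mono u n.le_succ).trans hD)
    exact dividers_succ_eq_of_profile_eq h hn hD (hn ▸ hD)

theorem dividers_eq_of_profile_dividers_eq {n : ℕ}
    (h : profile (dividers u n) u = profile (dividers v n) v) : dividers u n = dividers v n := by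
  have key : ∀ j ≤ n, dividers u j = dividers v j := by
    intro j
    induction j with
    | zero => exact fun _ => rfl
    | succ j ih =>
      intro hj
      exact dividers_succ_eq_of_profile_eq h (ih (by omega)) (dividers_mono u (by omega))
        (dividers_mono v (by omega))
  exact key n le_rfl

theorem dividers_subset (w : List α) (n : ℕ) : dividers w n ⊆ {a | a ∈ w} := by
  cases n with
  | zero => exact Set.empty_subset _
  | succ n =>
    rw [dividers_succ]
    exact fun a ha => ha.1

theorem exists_dividers_succ_subset (w : List α) : ∃ n, dividers w (n + 1) ⊆ dividers w n := by
  obtain ⟨m, -, n, -, hmn, h⟩ := Set.infinite_univ.exists_lt_map_eq_of_mapsTo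
    (fun n _ => dividers_subset w n) (List.finite_toSet w).finite_subsets
  exact ⟨m, h ▸ dividers_mono w hmn⟩

theorem IsBlock.mem_refineDividers_iff (h : IsBlock D p c r) (hac : a ∈ c)
    (hap : a ∉ p) : a ∈ refineDividers (p ++ c ++ r) D ↔ c.count a = 1 := by
  have hpos := List.count_pos_iff.2 hac
  constructor
  · intro ha
    have := ha.2 p c r rfl h.1 hap
    omega
  · refine fun hc => ⟨by simp [hac], fun p' z r' hw hz hap' => ?_⟩
    by_contra! hcount
    have hpc : (p ++ c).count a = 1 := by simp [hc, List.count_eq_zero.2 hap]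
    obtain ⟨t, ht, rfl⟩ | ⟨t, ht, -⟩ := List.append_eq_append_iff.1 hw
    · obtain _ | ⟨b, t⟩ := t
      · rw [← List.append_nil (p ++ c), ← ht, List.count_append] at hpc
        omega
      · obtain ⟨hbD, hb⟩ := h.2 b rfl
        have hbp' : b ∈ p' := (List.mem_append.1 (ht ▸ by simp)).elim id fun hbz => hz b hbz hbD
        obtain ⟨s, hs, -⟩ | ⟨s, hs, -⟩ := List.append_eq_append_iff.1 ht
        · exact hb (hs ▸ List.mem_append_left s hbp')
        · exact hap' (by simp [hs, hac])
    · rw [ht, List.count_append, List.count_append] at hpc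
      omega

theorem IsBlock.two_le_count (h : IsBlock D p c r) (hac : a ∈ c)
    (ha : a ∈ refineDividers (p ++ c ++ r) D → a ∈ p) : 2 ≤ (p ++ c).count a := by
  have hpos := List.count_pos_iff.2 hac
  rw [List.count_append]
  by_cases hap : a ∈ p
  · have := List.count_pos_iff.2 hap
    omega
  · have := mt (h.mem_refineDividers_iff hac hap).2 fun h => hap (ha h)
    omega

/-- One rewriting step that preserves the restrictors: insertion of letters that have occurred twice
to the left, or a swap of two adjacent factors that meet no divider. -/
inductive Step (D : Set α) : List α → List α → Prop
  | insert {p z : List α} (q : List α) (hz : ∀ a ∈ z, 2 ≤ p.count a) : Step D (p ++ q) (p ++ z ++ q)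
  | swap {p z z' : List α} (q : List α) (hz : Undivided D p (z ++ z')) :
      Step D (p ++ (z ++ z') ++ q) (p ++ (z' ++ z) ++ q)

theorem Step.profile_eq (h : Step D u v) : profile D u = profile D v := by
  cases h with
  | @insert p z q hz =>
    have hmem : ∀ a ∈ z, a ∈ p := fun a ha => List.count_pos_iff.1 (by have := hz a ha; omega)
    have hcount : ∀ a, min 2 ((p ++ []).count a) = min 2 ((p ++ z).count a) := fun a => by
      by_cases ha : a ∈ z
      · have := hz a ha
        rw [List.count_append, List.count_append]
        omega
      · simp [List.count_eq_zero.2 ha]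
    simpa using profile_append_append_congr (q := q) (z := []) (by simp [Undivided])
      (fun a ha _ => hmem a ha) hcount
  | swap q hz =>
    refine profile_append_append_congr hz (hz.of_subset List.perm_append_comm.subset) fun a => ?_
    simp only [List.count_append, Nat.add_comm]

theorem Step.append_right (h : Step D u v) (r : List α) : Step D (u ++ r) (v ++ r) := by
  cases h with
  | insert q hz => simpa only [List.append_assoc] using Step.insert (q ++ r) hz
  | swap q hz => simpa only [List.append_assoc] using Step.swap (q ++ r) hz

theorem profile_eq_of_eqvGen_step (h : Relation.EqvGen (Step D) u v) :
    profile D u = profile D v :=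
  Setoid.eqvGen_le (s := Setoid.ker (profile D)) (fun _ _ => Step.profile_eq) h

theorem eqvGen_step_append_right (h : Relation.EqvGen (Step D) u v) (r : List α) :
    Relation.EqvGen (Step D) (u ++ r) (v ++ r) :=
  Setoid.eqvGen_le (s := (Relation.EqvGen.setoid (Step D)).comap (· ++ r))
    (fun _ _ h => .rel _ _ (h.append_right r)) h

theorem exists_eqvGen_step_count_le_two (D : Set α) (u : List α) :
    ∃ v, Relation.EqvGen (Step D) u v ∧ ∀ a, v.count a ≤ 2 := by
  induction u using List.reverseRecOn with
  | nil => exact ⟨[], .refl _, by simp⟩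
  | append_singleton u b ih =>
    obtain ⟨v, huv, hv⟩ := ih
    have huvb := eqvGen_step_append_right huv [b]
    by_cases hb : 2 ≤ v.count b
    · refine ⟨v, huvb.trans _ _ _ (.symm _ _ (.rel _ _ ?_)), hv⟩
      simpa using Step.insert (D := D) (z := [b]) [] (by simpa using hb)
    · refine ⟨v ++ [b], huvb, fun a => ?_⟩
      have := hv a
      by_cases hab : b = a
      · subst hab
        simp only [List.count_append, List.count_singleton_self]
        omega
      · simpa [List.count_singleton, hab] using this

theorem undivided_concat_of_profile_eq (hz : z ≠ []) (haz : a ∉ z)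
    (hperm : (z ++ a :: r).Perm (a :: v)) (hcount : ∀ b ∈ z ++ a :: r, p.count b ≤ 1)
    (h : profile D (p ++ (z ++ a :: r)) = profile D (p ++ a :: v)) : Undivided D p (z ++ [a]) := by
  have hpz : Undivided D p z := undivided_of_profile_eq
    (by simpa only [List.append_assoc] using h.symm) haz (hcount a (by simp))
  obtain ⟨d, z, rfl⟩ := List.exists_cons_of_ne_nil hz
  have hda : d ≠ a := fun hda => haz (hda ▸ List.mem_cons_self)
  have hdv : d ∈ v := List.mem_of_ne_of_mem hda (hperm.subset (by simp))
  obtain ⟨v₁, v₂, rfl, hd⟩ := List.eq_append_cons_of_mem hdv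
  have hpa : Undivided D p (a :: v₁) := undivided_of_profile_eq (a := d)
    (by simpa only [List.append_assoc, List.cons_append] using h)
    (List.not_mem_cons_of_ne_of_not_mem hda hd) (hcount d (by simp))
  intro b hb
  obtain hb | hb := List.mem_append.1 hb
  · exact hpz b hb
  · exact hpa b (List.mem_singleton.1 hb ▸ List.mem_cons_self)

theorem eqvGen_step_of_perm (hperm : u.Perm v) (hcount : ∀ a, (p ++ u).count a ≤ 2)
    (h : profile D (p ++ u) = profile D (p ++ v)) :
    Relation.EqvGen (Step D) (p ++ u) (p ++ v) := by
  induction v generalizing p u with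
  | nil =>
    rw [hperm.eq_nil]
    exact .refl _
  | cons b v ih =>
    obtain ⟨z, r, rfl, hbz⟩ := List.eq_append_cons_of_mem (hperm.mem_iff.2 List.mem_cons_self)
    have hp : ∀ a ∈ z ++ b :: r, p.count a ≤ 1 := fun a ha => by
      have := hcount a
      have := List.count_pos_iff.2 ha
      simp only [List.count_append] at *
      omega
    have hmove : Relation.EqvGen (Step D) (p ++ (z ++ b :: r)) (p ++ [b] ++ (z ++ r)) := by
      obtain rfl | hz := eq_or_ne z []
      · simpa using .refl _
      · refine .rel _ _ ?_
        simpa using Step.swap r (undivided_concat_of_profile_eq hz hbz hperm hp h)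
    have hmiddle : (z ++ b :: r).Perm ([b] ++ (z ++ r)) := List.perm_middle
    rw [List.append_cons p b v] at h ⊢
    refine hmove.trans _ _ _ (ih (hmiddle.symm.trans hperm).cons_inv (fun a => ?_) ?_)
    · rw [List.append_assoc, ← (hmiddle.append_left p).count_eq]
      exact hcount a
    · exact (profile_eq_of_eqvGen_step hmove).symm.trans h

theorem eqvGen_step_of_profile_eq (h : profile D u = profile D v) :
    Relation.EqvGen (Step D) u v := by
  obtain ⟨u', hu, hu'⟩ := exists_eqvGen_step_count_le_two D u
  obtain ⟨v', hv, hv'⟩ := exists_eqvGen_step_count_le_two D v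
  have h' : profile D u' = profile D v' :=
    (profile_eq_of_eqvGen_step hu).symm.trans (h.trans (profile_eq_of_eqvGen_step hv))
  have hperm : u'.Perm v' := List.perm_iff_count.2 fun a => by
    have := min_count_eq_of_profile_eq h' a
    have := hu' a
    have := hv' a
    omega
  exact hu.trans _ _ _ ((eqvGen_step_of_perm (p := []) hperm hu' h').trans _ _ _ (hv.symm _ _))

end Words

/-! ### Consequences of identities -/

section EquationalLogic

variable {S : Set Identity}

/-- The fully invariant congruence on words generated by the identities in `S`. -/
def consequences (S : Set Identity) : Con Word :=
  conGen fun p q => ∃ e ∈ S, ∃ φ : Letter → Word,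
    p = FreeMonoid.lift φ e.1 ∧ q = FreeMonoid.lift φ e.2

theorem Satisfies.of_injective {M N : Type*} [Monoid M] [Monoid N] {e : Identity}
    (h : Satisfies N e) (f : M →* N) (hf : Function.Injective f) : Satisfies M e := fun φ =>
  hf (by rw [FreeMonoid.hom_map_lift, FreeMonoid.hom_map_lift]; exact h (f ∘ φ))

theorem satisfies_quotient_consequences {e : Identity} (he : e ∈ S) :
    Satisfies (consequences S).Quotient e := by
  intro φ
  obtain ⟨ψ, rfl⟩ := (consequences S).mk'_surjective.comp_left φ
  rw [← FreeMonoid.hom_map_lift, ← FreeMonoid.hom_map_lift]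
  exact (consequences S).eq.2 (ConGen.Rel.of _ _ ⟨e, he, ψ, rfl, rfl⟩)

theorem holdsIn_var_of_consequences {u v : Word} (h : consequences S u v) :
    HoldsIn.{w} (var.{w} S) (u, v) := by
  intro M hM φ
  suffices consequences S ≤ Con.ker (FreeMonoid.lift φ) from this h
  refine Con.conGen_le.2 ?_
  rintro _ _ ⟨e, he, ψ, rfl, rfl⟩
  rw [Con.ker_rel, FreeMonoid.hom_map_lift, FreeMonoid.hom_map_lift]
  exact hM e he _

theorem consequences_of_holdsIn_var {u v : Word} (h : HoldsIn.{w} (var.{w} S) (u, v)) :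
    consequences S u v := by
  let f : ULift.{w} (consequences S).Quotient ≃* (consequences S).Quotient := MulEquiv.ulift
  have hmem : MonCat.of (ULift.{w} (consequences S).Quotient) ∈ var.{w} S := fun e he =>
    (satisfies_quotient_consequences he).of_injective f.toMonoidHom f.injective
  have huv : Satisfies (consequences S).Quotient (u, v) :=
    (h _ hmem).of_injective f.symm.toMonoidHom f.symm.injective
  have := huv ((consequences S).mk' ∘ FreeMonoid.of)
  rw [FreeMonoid.lift_restrict] at this
  exact (consequences S).eq.1 this

theorem holdsIn_var_iff {u v : Word} :
    HoldsIn.{w} (var.{w} S) (u, v) ↔ consequences S u v :=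
  ⟨consequences_of_holdsIn_var, holdsIn_var_of_consequences⟩

/-- The identity between the words with the letters listed in `u` and in `v` follows from `S`. -/
def Derives (S : Set Identity) (u v : List Letter) : Prop :=
  consequences S (FreeMonoid.ofList u) (FreeMonoid.ofList v)

variable {p q u v u' v' w z z' : List Letter}

theorem Derives.refl (S : Set Identity) (u : List Letter) : Derives S u u :=
  (consequences S).refl _

theorem Derives.symm (h : Derives S u v) : Derives S v u := (consequences S).symm h

theorem Derives.trans (h : Derives S u v) (h' : Derives S v w) : Derives S u w :=
  (consequences S).trans h h'

theorem Derives.append (h : Derives S u v) (h' : Derives S u' v') :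
    Derives S (u ++ u') (v ++ v') := by
  rw [Derives, FreeMonoid.ofList_append, FreeMonoid.ofList_append]
  exact (consequences S).mul h h'

theorem Derives.append_right (h : Derives S u v) (q : List Letter) :
    Derives S (u ++ q) (v ++ q) := h.append (.refl S q)

theorem Derives.append_left (p : List Letter) (h : Derives S u v) :
    Derives S (p ++ u) (p ++ v) := (Derives.refl S p).append h

theorem Derives.of_mem {e : Identity} (he : e ∈ S) (φ : Letter → Word)
    (hu : FreeMonoid.lift φ e.1 = FreeMonoid.ofList u)
    (hv : FreeMonoid.lift φ e.2 = FreeMonoid.ofList v) : Derives S u v :=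
  ConGen.Rel.of _ _ ⟨e, he, φ, hu.symm, hv.symm⟩

theorem derives_repeat (hS : Phi ⊆ S) (p q : List Letter) :
    Derives S (p ++ q ++ p) (p ++ q ++ p ++ p) :=
  .of_mem (hS (by simp [Phi]) : (x 0 * y 0 * x 0, x 0 * y 0 * x 0 ^ 2) ∈ S)
    (fun i => if i = 0 then FreeMonoid.ofList p else FreeMonoid.ofList q)
    (by simp [x, y, FreeMonoid.ofList_append, mul_assoc])
    (by simp [x, y, FreeMonoid.ofList_append, pow_two, mul_assoc])

theorem derives_squares_comm (hS : Phi ⊆ S) (p q : List Letter) :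
    Derives S (p ++ p ++ q ++ q) (q ++ q ++ p ++ p) :=
  .of_mem (hS (by simp [Phi]) : (x 0 ^ 2 * y 0 ^ 2, y 0 ^ 2 * x 0 ^ 2) ∈ S)
    (fun i => if i = 0 then FreeMonoid.ofList p else FreeMonoid.ofList q)
    (by simp [x, y, FreeMonoid.ofList_append, pow_two, mul_assoc])
    (by simp [x, y, FreeMonoid.ofList_append, pow_two, mul_assoc])

theorem derives_square_insert (hS : Phi ⊆ S) (p q : List Letter) :
    Derives S (p ++ p ++ q) (p ++ p ++ q ++ p) :=
  .of_mem (hS (by simp [Phi]) : (x 0 ^ 2 * y 0, x 0 ^ 2 * y 0 * x 0) ∈ S)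
    (fun i => if i = 0 then FreeMonoid.ofList p else FreeMonoid.ofList q)
    (by simp [x, y, FreeMonoid.ofList_append, pow_two, mul_assoc])
    (by simp [x, y, FreeMonoid.ofList_append, pow_two, mul_assoc])

theorem derives_concat (hS : Phi ⊆ S) {a : Letter} (h : 2 ≤ p.count a) :
    Derives S p (p ++ [a]) := by
  obtain ⟨r, t, rfl, hr⟩ := exists_append_of_lt_count h
  obtain ⟨r, s, rfl⟩ := List.append_of_mem (List.count_pos_iff.1 (hr ▸ one_pos))
  have hrepeat : Derives S (r ++ [a] ++ s ++ [a] ++ t) (r ++ [a] ++ s ++ [a] ++ [a] ++ t) := by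
    simpa only [List.append_assoc] using
      ((derives_repeat hS [a] s).append_left r).append_right t
  have hinsert : Derives S (r ++ [a] ++ s ++ [a] ++ [a] ++ t)
      (r ++ [a] ++ s ++ [a] ++ [a] ++ t ++ [a]) := by
    simpa only [List.append_assoc] using
      (derives_square_insert hS [a] t).append_left (r ++ [a] ++ s)
  simpa using (hrepeat.trans hinsert).trans (hrepeat.append_right [a]).symm

theorem derives_append (hS : Phi ⊆ S) (h : ∀ a ∈ z, 2 ≤ p.count a) : Derives S p (p ++ z) := by
  induction z using List.reverseRecOn with
  | nil =>
    rw [List.append_nil]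
    exact .refl S p
  | append_singleton z a ih =>
    have ha : 2 ≤ (p ++ z).count a := by
      have := h a (by simp)
      rw [List.count_append]
      omega
    rw [← List.append_assoc]
    exact (ih fun b hb => h b (List.mem_append_left _ hb)).trans (derives_concat hS ha)

theorem derives_insert (hS : Phi ⊆ S) (q : List Letter) (h : ∀ a ∈ z, 2 ≤ p.count a) :
    Derives S (p ++ q) (p ++ z ++ q) :=
  (derives_append hS h).append_right q

/-- Both sides absorb `z z z' z'` up to the order of the two squares, which commute. -/
theorem derives_replace (hS : Phi ⊆ S) (q : List Letter)
    (hz : ∀ a ∈ z ++ z', 2 ≤ (p ++ z).count a) (hz' : ∀ a ∈ z ++ z', 2 ≤ (p ++ z').count a) :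
    Derives S (p ++ z ++ q) (p ++ z' ++ q) := by
  have hleft : Derives S (p ++ z ++ q) (p ++ (z ++ z ++ z' ++ z') ++ q) := by
    simpa only [List.append_assoc] using derives_insert hS (p := p ++ z) (z := z ++ z' ++ z') q
      fun a ha => hz a (by simpa using ha)
  have hright : Derives S (p ++ z' ++ q) (p ++ (z' ++ z' ++ z ++ z) ++ q) := by
    simpa only [List.append_assoc] using derives_insert hS (p := p ++ z') (z := z' ++ z ++ z) q
      fun a ha => hz' a (by simpa [or_comm] using ha)
  exact (hleft.trans (((derives_squares_comm hS z z').append_left p).append_right q)).trans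
    hright.symm

/-- The image of the word `b s` under the substitution `x i ↦ ψ i`. -/
def substB (ψ : ℕ → List Letter) : ℕ → List Letter
  | 0 => []
  | s + 1 => ψ s ++ ψ (s + 1) ++ substB ψ s

theorem lift_b (φ : Letter → Word) (s : ℕ) :
    FreeMonoid.lift φ (b s) = FreeMonoid.ofList (substB (fun i => (φ (2 * i)).toList) s) := by
  induction s with
  | zero => rfl
  | succ s ih => simp [b, x, substB, ih, FreeMonoid.ofList_append, mul_assoc]

theorem substB_congr {ψ ψ' : ℕ → List Letter} {s : ℕ} (h : ∀ i ≤ s, ψ i = ψ' i) :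
    substB ψ s = substB ψ' s := by
  induction s with
  | zero => rfl
  | succ s ih =>
    rw [substB, substB, ih fun i hi => h i (by omega), h s (by omega), h (s + 1) le_rfl]

theorem derives_alpha {s : ℕ} (hS : alpha (s + 1) ∈ S) (ψ : ℕ → List Letter)
    (p q : List Letter) : Derives S (p ++ q ++ ψ s ++ p ++ q ++ substB ψ s)
      (q ++ p ++ ψ s ++ p ++ q ++ substB ψ s) := by
  let φ : Letter → Word := fun i => if i = 2 * (s + 1) then FreeMonoid.ofList p else
    if i = 2 * (s + 1) + 1 then FreeMonoid.ofList q else FreeMonoid.ofList (ψ (i / 2))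
  have hp : φ (2 * (s + 1)) = FreeMonoid.ofList p := if_pos rfl
  have hq : φ (2 * (s + 1) + 1) = FreeMonoid.ofList q := by simp [φ]
  have hψ : ∀ i ≤ s, φ (2 * i) = FreeMonoid.ofList (ψ i) := fun i hi => by
    simp [φ, show i ≠ s + 1 by omega, show 2 * i ≠ 2 * (s + 1) + 1 by omega]
  have hb : FreeMonoid.lift φ (b s) = FreeMonoid.ofList (substB ψ s) := by
    rw [lift_b, substB_congr fun i hi => by rw [hψ i hi, FreeMonoid.toList_ofList]]
  refine .of_mem hS φ ?_ ?_ <;>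
  · simp only [alpha, Nat.add_sub_cancel, map_mul, hb, x, y, FreeMonoid.lift_eval_of, hp, hq,
      hψ s le_rfl, FreeMonoid.ofList_append]

/-- The words `ψ s, …, ψ 0` are read one after another to the right of `z`, each up to the end of
the block in the next coarser decomposition. -/
theorem exists_derives_substB (hS : Phi ⊆ S) {s : ℕ}
    (hz : Undivided (dividers (p ++ z ++ q) (s + 1)) p z) :
    ∃ ψ : ℕ → List Letter, ∀ p' : List Letter, (∀ a, min 2 ((p ++ z).count a) ≤ p'.count a) →
      Derives S (p' ++ q) (p' ++ ψ s ++ z ++ substB ψ s) := by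
  induction s generalizing z q with
  | zero =>
    refine ⟨fun _ => q, fun p' hp' => ?_⟩
    have hblock : IsBlock ∅ p (z ++ q) [] := by simp [IsBlock, Undivided]
    rw [substB, List.append_nil]
    refine derives_append hS fun a ha => ?_
    have := hp' a
    have := hblock.two_le_count (List.mem_append_left q ha)
      (by simpa [dividers_succ, dividers] using hz a ha)
    simp only [List.count_append] at *
    omega
  | succ s ih =>
    obtain ⟨g, r, rfl, hg⟩ := exists_isBlock (dividers (p ++ z ++ q) (s + 1)) (p ++ z) q
    have hw : p ++ z ++ (g ++ r) = p ++ (z ++ g) ++ r := by simp only [List.append_assoc]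
    rw [hw] at hz hg
    have hblock := hg.append_left (hz.anti (dividers_mono _ (s + 1).le_succ))
    obtain ⟨ψ, hψ⟩ := ih hblock.1
    refine ⟨Function.update ψ (s + 1) g, fun p' hp' => ?_⟩
    have hbound : ∀ a, min 2 ((p ++ (z ++ g)).count a) ≤ (p' ++ g).count a := fun a => by
      have := hp' a
      simp only [List.count_append] at *
      omega
    have htwo : ∀ a ∈ z, 2 ≤ (p' ++ g).count a := fun a ha => by
      rw [dividers_succ] at hz
      have := hblock.two_le_count (List.mem_append_left g ha) (hz a ha)
      have := hbound a
      omega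
    have hb : substB (Function.update ψ (s + 1) g) s = substB ψ s :=
      substB_congr fun i hi => Function.update_of_ne (by omega) _ _
    rw [substB, hb, Function.update_self, Function.update_of_ne (by omega)]
    have hsubst := hψ (p' ++ g) hbound
    have hleft := derives_insert hS (ψ s ++ g ++ substB ψ s) htwo
    have hright := derives_insert hS (p := p' ++ g ++ ψ s) (g ++ substB ψ s) fun a ha => by
      rw [List.count_append]
      exact (htwo a ha).trans (Nat.le_add_right _ _)
    simp only [List.append_assoc] at hsubst hleft hright ⊢
    exact (hsubst.trans hright.symm).trans hleft

theorem Step.derives_of_alpha_mem {n : ℕ} {D : Set Letter} (hS : Phi ⊆ S)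
    (hα : alpha (n + 1) ∈ S) (h : Step D u v) (hD : dividers u (n + 1) = D) : Derives S u v := by
  cases h with
  | insert q hz => exact derives_insert hS q hz
  | @swap p z z' q hz =>
    obtain ⟨ψ, hψ⟩ := exists_derives_substB hS (hD ▸ hz)
    have hleft := hψ (p ++ (z ++ z')) fun _ => min_le_right _ _
    have hright := hψ (p ++ (z' ++ z)) fun a =>
      (min_le_right _ _).trans ((List.perm_append_comm.append_left p).count_eq a).le
    have hswap := (derives_alpha hα ψ z z').append_left p
    simp only [List.append_assoc] at hleft hright hswap ⊢
    exact (hleft.trans hswap).trans hright.symm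

theorem Step.derives_of_refineDividers_subset {D : Set Letter} (hS : Phi ⊆ S) (h : Step D u v)
    (hD : refineDividers u D ⊆ D) : Derives S u v := by
  cases h with
  | insert q hz => exact derives_insert hS q hz
  | @swap p z z' q hz =>
    obtain ⟨g, r, rfl, hg⟩ := exists_isBlock D (p ++ (z ++ z')) q
    have hblock := hg.append_left hz
    have hcount : ∀ a ∈ z ++ z' ++ g, 2 ≤ (p ++ (z ++ z' ++ g)).count a := fun a ha =>
      hblock.two_le_count ha fun h =>
        hblock.1 a ha (hD (by simpa only [List.append_assoc] using h))
    have hperm : (z ++ z' ++ g).Perm (z' ++ z ++ g) := List.perm_append_comm.append_right g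
    have := derives_replace hS (p := p) (z := z ++ z' ++ g) (z' := z' ++ z ++ g) r
      (fun a ha => hcount a (by simpa [or_comm, or_left_comm] using ha))
      (fun a ha => (hperm.append_left p).count_eq a ▸
        hcount a (by simpa [or_comm, or_left_comm] using ha))
    simpa only [List.append_assoc] using this

theorem derives_of_eqvGen_step {D : Set Letter} {P : List Letter → Prop}
    (hP : ∀ {u v}, profile D u = profile D v → P u → P v)
    (hstep : ∀ {u v}, Step D u v → P u → Derives S u v)
    (h : Relation.EqvGen (Step D) u v) (hu : P u) : Derives S u v := by
  induction h with
  | rel _ _ h => exact hstep h hu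
  | refl u => exact .refl S u
  | symm _ _ huv ih =>
    exact (ih (hP (profile_eq_of_eqvGen_step huv).symm hu)).symm
  | trans _ _ _ huv _ ihu ihv =>
    exact (ihu hu).trans (ihv (hP (profile_eq_of_eqvGen_step huv) hu))

theorem derives_of_profile_dividers_eq {n : ℕ} (hS : Phi ⊆ S) (hα : alpha (n + 1) ∈ S)
    (h : profile (dividers u (n + 1)) u = profile (dividers v (n + 1)) v) : Derives S u v :=
  derives_of_eqvGen_step (P := fun w => dividers w (n + 1) = dividers u (n + 1))
    (fun h hu => (dividers_eq_of_profile_eq h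
      (hu ▸ dividers_mono _ n.le_succ)).symm.trans hu)
    (fun h => h.derives_of_alpha_mem hS hα)
    (eqvGen_step_of_profile_eq (h.trans (by rw [dividers_eq_of_profile_dividers_eq h]))) rfl

theorem derives_of_forall_profile_dividers_eq (hS : Phi ⊆ S)
    (h : ∀ n, profile (dividers u (n + 1)) u = profile (dividers v (n + 1)) v) :
    Derives S u v := by
  obtain ⟨n, hn⟩ := exists_dividers_succ_subset u
  have hn' : dividers u (n + 2) ⊆ dividers u (n + 1) := by
    simpa only [dividers_succ] using refineDividers_mono u hn
  refine derives_of_eqvGen_step (D := dividers u (n + 1))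
    (P := fun w => refineDividers w (dividers u (n + 1)) ⊆ dividers u (n + 1))
    (fun h hu => refineDividers_eq_of_profile_eq h ▸ hu)
    (fun h => h.derives_of_refineDividers_subset hS) (eqvGen_step_of_profile_eq ?_)
    (dividers_succ u (n + 1) ▸ hn')
  rw [h n, dividers_eq_of_profile_dividers_eq (h n)]

theorem Step.profile_dividers_eq {n : ℕ} (h : Step (dividers u n) u v) :
    profile (dividers u n) u = profile (dividers v n) v := by
  have hn : dividers u n = dividers v n := by
    cases n with
    | zero => rfl
    | succ n => exact dividers_eq_of_profile_eq h.profile_eq (dividers_mono u n.le_succ)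
  rw [← hn]
  exact h.profile_eq

theorem undivided_dividers_succ {n : ℕ} (hw : w = p ++ (z ++ z') ++ q)
    (hz : ∀ a ∈ z, 2 ≤ (z ++ z').count a) (h : Undivided (dividers w n) p (z ++ z')) :
    Undivided (dividers w (n + 1)) p z := fun a ha haD => by
  subst hw
  by_contra hap
  rw [dividers_succ] at haD
  exact h.notMem_refineDividers hap (hz a ha) haD

theorem undivided_dividers_of_two_le_count (p q : List Letter) (hz : ∀ a ∈ z, 2 ≤ z.count a)
    (n : ℕ) : Undivided (dividers (p ++ z ++ q) n) p z := by
  induction n with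
  | zero => exact fun _ _ h => h.elim
  | succ n ih =>
    exact undivided_dividers_succ (z' := []) (q := q) (by rw [List.append_nil])
      (by rwa [List.append_nil]) (by rwa [List.append_nil])

theorem undivided_dividers_substB {ψ : ℕ → List Letter} {s : ℕ}
    (hw : w = p ++ (z ++ (ψ s ++ z')) ++ (substB ψ s ++ q))
    (hz : ∀ a ∈ z ++ z', 2 ≤ (z ++ (ψ s ++ z')).count a) :
    Undivided (dividers w (s + 1)) p z := by
  refine undivided_dividers_succ hw (fun a ha => hz a (List.mem_append_left z' ha)) ?_
  induction s generalizing z z' with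
  | zero => exact fun _ _ h => h.elim
  | succ s ih =>
    have hw' : w = p ++ (z ++ (ψ (s + 1) ++ z') ++ (ψ s ++ ψ (s + 1))) ++ (substB ψ s ++ q) := by
      simpa only [substB, List.append_assoc] using hw
    have hz' : ∀ a ∈ z ++ (ψ (s + 1) ++ z') ++ ψ (s + 1),
        2 ≤ (z ++ (ψ (s + 1) ++ z') ++ (ψ s ++ ψ (s + 1))).count a := fun a ha => by
      by_cases haz : a ∈ z ++ z'
      · rw [List.count_append]
        exact (hz a haz).trans (Nat.le_add_right _ _)
      · have := List.count_pos_iff.2 (show a ∈ ψ (s + 1) by grind)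
        simp only [List.count_append]
        omega
    exact undivided_dividers_succ hw' (fun a ha => hz' a (List.mem_append_left _ ha)) (ih hw' hz')

/-- The largest congruence contained in the equality of profiles: two words are related if they
have the same restrictors in every context. -/
def profileCon (n : ℕ) : Con Word where
  r u v := ∀ p q : Word, profile (dividers (p * u * q).toList n) (p * u * q).toList =
    profile (dividers (p * v * q).toList n) (p * v * q).toList
  iseqv := ⟨fun _ _ _ => rfl, fun h p q => (h p q).symm, fun h h' p q => (h p q).trans (h' p q)⟩
  mul' {u v u' v'} h h' p q := by
    have hleft := h p (u' * q)
    have hright := h' (p * v) q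
    simp only [mul_assoc] at hleft hright ⊢
    exact hleft.trans hright

theorem profileCon_of_mem_Phi {e : Identity} (he : e ∈ Phi) (φ : Letter → Word) (n : ℕ) :
    profileCon n (FreeMonoid.lift φ e.1) (FreeMonoid.lift φ e.2) := by
  intro p q
  have hinsert (r : Word) (hr : ∀ a ∈ (φ 0).toList, 2 ≤ r.toList.count a) :=
    (Step.insert (D := dividers ((p * r).toList ++ q.toList) n) q.toList (z := (φ 0).toList)
      fun a ha => by simpa using (hr a ha).trans (Nat.le_add_left _ _)).profile_dividers_eq
  obtain rfl | rfl | rfl := he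
  · have := hinsert (φ 0 * φ 1 * φ 0) fun a ha => by
      have := List.count_pos_iff.2 ha
      simp only [FreeMonoid.toList_mul, List.count_append]
      omega
    simpa [x, y, pow_two] using this
  · have hundivided := undivided_dividers_of_two_le_count p.toList q.toList
      (z := (φ 0).toList ++ (φ 0).toList ++ ((φ 1).toList ++ (φ 1).toList)) (fun a ha => by
        have := List.count_pos_iff.2 ha
        simp only [List.count_append] at this ⊢
        omega) n
    simpa [x, y, pow_two] using (Step.swap q.toList hundivided).profile_dividers_eq
  · have := hinsert (φ 0 * φ 0 * φ 1) fun a ha => by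
      have := List.count_pos_iff.2 ha
      simp only [FreeMonoid.toList_mul, List.count_append]
      omega
    simpa [x, y, pow_two] using this

theorem profileCon_alpha (φ : Letter → Word) (n : ℕ) :
    profileCon (n + 1) (FreeMonoid.lift φ (alpha (n + 1)).1)
      (FreeMonoid.lift φ (alpha (n + 1)).2) := by
  intro p q
  set u := (φ (2 * (n + 1))).toList with hu
  set v := (φ (2 * (n + 1) + 1)).toList with hv
  have hundivided := undivided_dividers_substB (ψ := fun i => (φ (2 * i)).toList) (s := n)
    (p := p.toList) (z := u ++ v) (z' := u ++ v) (q := q.toList) rfl fun a ha => by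
      have := List.count_pos_iff.2 ha
      simp only [List.count_append] at this ⊢
      omega
  have := (Step.swap ((φ (2 * n)).toList ++ (u ++ v) ++
    (substB (fun i => (φ (2 * i)).toList) n ++ q.toList)) (D := dividers _ (n + 1))
    (by simpa only [List.append_assoc] using hundivided)).profile_dividers_eq
  simpa [alpha, x, y, lift_b, hu, hv] using this

theorem consequences_Phi_alpha_iff {n : ℕ} {u v : Word} :
    consequences (Phi ∪ {alpha (n + 1)}) u v ↔
      profile (dividers u.toList (n + 1)) u.toList =
        profile (dividers v.toList (n + 1)) v.toList := by
  refine ⟨fun h => ?_, derives_of_profile_dividers_eq Set.subset_union_left (Or.inr rfl)⟩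
  suffices consequences (Phi ∪ {alpha (n + 1)}) ≤ profileCon (n + 1) by simpa using this h 1 1
  refine Con.conGen_le.2 ?_
  rintro _ _ ⟨e, he | rfl, φ, rfl, rfl⟩
  · exact profileCon_of_mem_Phi he φ (n + 1)
  · exact profileCon_alpha φ n

theorem consequences_Phi_iff {u v : Word} :
    consequences Phi u v ↔ ∀ n, profile (dividers u.toList (n + 1)) u.toList =
      profile (dividers v.toList (n + 1)) v.toList := by
  refine ⟨fun h n => consequences_Phi_alpha_iff.1 ?_,
    derives_of_forall_profile_dividers_eq subset_rfl⟩
  have : consequences Phi ≤ consequences (Phi ∪ {alpha (n + 1)}) :=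
    Con.conGen_mono fun _ _ ⟨e, he, h⟩ => ⟨e, Or.inl he, h⟩
  exact this h

end EquationalLogic

/-! ### Decompositions -/

section Decompositions

variable {D : Set Letter} {l p q : List Letter} {a : Letter} {d e : Decomposition}

/-- The word factorized by `d`. -/
def flatten (d : Decomposition) : List Letter := d.flatMap fun tc => tc.1.toList ++ tc.2

theorem flatten_cons (t : Option Letter) (c : List Letter) (d : Decomposition) :
    flatten ((t, c) :: d) = t.toList ++ c ++ flatten d := by
  simp [flatten]

theorem flatten_append (d e : Decomposition) : flatten (d ++ e) = flatten d ++ flatten e :=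
  List.flatMap_append

theorem flatten_split (f : Letter → Bool) (t : Option Letter) (c w : List Letter) :
    flatten (split f t c w) = t.toList ++ c ++ w := by
  induction w generalizing t c with
  | nil => simp [split, flatten]
  | cons a w ih =>
    rw [split]
    split_ifs
    · simp [flatten_cons, ih]
    · simp [ih]

theorem flatten_refine (l : List Letter) (d : Decomposition) :
    flatten (refine l d) = flatten d := by
  induction d generalizing l with
  | nil => rfl
  | cons tc d ih => rw [refine, flatten_append, flatten_split, ih, flatten_cons, List.append_nil]

/-- After the left context `l`, the factorization `d` is the one whose dividers are the first
occurrences of the letters of `D`. -/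
def IsDecomposition (D : Set Letter) : List Letter → Decomposition → Prop
  | _, [] => True
  | l, (t, c) :: d =>
      (∀ a ∈ t, a ∈ D ∧ a ∉ l) ∧ IsBlock D (l ++ t.toList) c (flatten d) ∧
        IsDecomposition D (l ++ t.toList ++ c) d

theorem isDecomposition_split_append {f : Letter → Bool} {t : Option Letter} {c w : List Letter}
    (ht : ∀ a ∈ t, a ∈ D ∧ a ∉ l) (hc : Undivided D (l ++ t.toList) c)
    (hf : ∀ p a q, w = p ++ a :: q → (f a ↔ a ∈ D ∧ a ∉ l ++ t.toList ++ c ++ p))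
    (hw : ∀ b ∈ (flatten e).head?, b ∈ D ∧ b ∉ l ++ t.toList ++ c ++ w)
    (he : IsDecomposition D (l ++ t.toList ++ c ++ w) e) :
    IsDecomposition D l (split f t c w ++ e) := by
  induction w generalizing l t c with
  | nil =>
    rw [List.append_nil] at hw he
    exact ⟨ht, ⟨hc, hw⟩, he⟩
  | cons a w ih =>
    have ha : f a ↔ a ∈ D ∧ a ∉ l ++ t.toList ++ c := by simpa using hf [] a w rfl
    have hf' : ∀ p b q, w = p ++ b :: q → (f b ↔ b ∈ D ∧ b ∉ l ++ t.toList ++ c ++ [a] ++ p) :=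
      fun p b q hp => by simpa using hf (a :: p) b q (by simp [hp])
    rw [List.append_cons] at hw he
    rw [split]
    split_ifs with hfa
    · refine ⟨ht, ⟨hc, ?_⟩, ih ?_ ?_ ?_ ?_ ?_⟩
      · simpa [flatten_append, flatten_split] using ha.1 hfa
      · simpa using ha.1 hfa
      · simp [Undivided]
      · simpa using hf'
      · simpa using hw
      · simpa using he
    · refine ih ht (undivided_append.2 ⟨hc, ?_⟩) ?_ ?_ ?_
      · exact by_contra fun h => hfa (ha.2 (not_undivided_singleton.1 h))
      · simpa only [List.append_assoc] using hf'
      · simpa only [List.append_assoc] using hw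
      · simpa only [List.append_assoc] using he

theorem IsDecomposition.refine {w : List Letter} (h : IsDecomposition D l d)
    (hw : w = l ++ flatten d) (hD : D ⊆ refineDividers w D) :
    IsDecomposition (refineDividers w D) l (refine l d) := by
  induction d generalizing l with
  | nil => trivial
  | cons tc d ih =>
    obtain ⟨t, c⟩ := tc
    obtain ⟨ht, hblock, hd⟩ := h
    have hw' : w = l ++ t.toList ++ c ++ flatten d := by simpa [flatten_cons] using hw
    refine isDecomposition_split_append (fun a ha => (ht a ha).imp_left (@hD a))
      (by simp [Undivided]) (fun p a q hc => ?_) ?_ ?_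
    · have hac : a ∈ c := by simp [hc]
      have hcount (hal : a ∉ l ++ t.toList) : a ∈ refineDividers w D ↔ c.count a = 1 :=
        hw' ▸ hblock.mem_refineDividers_iff hac hal
      have hap (h : c.count a = 1) : a ∉ p := fun hap => by
        have := List.count_pos_iff.2 hap
        simp only [hc, List.count_append, List.count_cons_self] at h
        omega
      rw [List.append_nil, decide_eq_true_iff, List.mem_append (t := p)]
      tauto
    · rw [flatten_refine, List.append_nil]
      exact fun b hb => (hblock.2 b hb).imp_left (@hD b)
    · rw [List.append_nil]
      exact ih hd hw'

theorem isDecomposition_decomposition (w : Word) (n : ℕ) :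
    IsDecomposition (dividers w.toList (n + 1)) [] (decomposition w n) ∧
      flatten (decomposition w n) = w.toList := by
  induction n with
  | zero =>
    have hrefine : decomposition w 0 = refine [] [(none, w.toList)] := by
      rw [decomposition, refine, refine, List.append_nil]
      congr 1
      ext a
      rw [Bool.eq_iff_iff, decide_eq_true_iff, decide_eq_true_iff]
      simp [occ]
    have hflatten : flatten [(none, w.toList)] = w.toList := by simp [flatten]
    have hblock : IsDecomposition ∅ [] [(none, w.toList)] := by
      simp [IsDecomposition, IsBlock, Undivided, flatten]
    rw [hrefine, flatten_refine]
    exact ⟨hblock.refine hflatten.symm (Set.empty_subset _), hflatten⟩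
  | succ n ih =>
    obtain ⟨hdecomp, hflatten⟩ := ih
    rw [decomposition, flatten_refine, dividers_succ]
    refine ⟨hdecomp.refine hflatten.symm ?_, hflatten⟩
    rw [← dividers_succ]
    exact dividers_mono w.toList (n + 1).le_succ

theorem map_fst_marked (d : Decomposition) : (marked d).map Prod.fst = flatten d := by
  simp [marked, flatten, List.map_flatMap, Function.comp_def]

/-- After the left context `l`, the mark `true` in `m` stands exactly at the first occurrences of
the letters of `D`. -/
def IsMarking (D : Set Letter) : List Letter → List (Letter × Bool) → Prop
  | _, [] => True
  | l, (a, β) :: m => (β ↔ a ∈ D ∧ a ∉ l) ∧ IsMarking D (l ++ [a]) m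

theorem isMarking_append {m m' : List (Letter × Bool)} :
    IsMarking D l (m ++ m') ↔ IsMarking D l m ∧ IsMarking D (l ++ m.map Prod.fst) m' := by
  induction m generalizing l with
  | nil => simp [IsMarking]
  | cons c m ih => simp [IsMarking, ih, and_assoc]

theorem isMarking_map_false {c : List Letter} (hc : Undivided D l c) :
    IsMarking D l (c.map fun a => (a, false)) := by
  induction c generalizing l with
  | nil => trivial
  | cons a c ih =>
    rw [← List.singleton_append, undivided_append] at hc
    refine ⟨?_, ih hc.2⟩
    simpa using mt not_undivided_singleton.2 (not_not.2 hc.1)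

theorem IsDecomposition.isMarking (h : IsDecomposition D l d) : IsMarking D l (marked d) := by
  induction d generalizing l with
  | nil => trivial
  | cons tc d ih =>
    obtain ⟨t, c⟩ := tc
    obtain ⟨ht, hblock, hd⟩ := h
    rw [marked, List.flatMap_cons, isMarking_append, isMarking_append]
    refine ⟨⟨?_, ?_⟩, ?_⟩
    · cases t <;> simp_all [IsMarking]
    · simpa [Function.comp_def] using isMarking_map_false hblock.1
    · simpa [Function.comp_def, marked] using ih hd

theorem IsMarking.getLast?_filter {m : List (Letter × Bool)} (h : IsMarking D [] m) :
    (m.filter fun c => c.2).getLast?.map Prod.fst = lastDivider D (m.map Prod.fst) := by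
  induction m using List.reverseRecOn with
  | nil => simp [lastDivider]
  | append_singleton m c ih =>
    obtain ⟨a, β⟩ := c
    obtain ⟨hm, ha, -⟩ := isMarking_append.1 h
    rw [List.nil_append] at ha
    rw [List.map_append, List.filter_append]
    cases β with
    | true =>
      rw [List.map_singleton, lastDivider_concat_of_divides (ha.1 rfl).2 (ha.1 rfl).1]
      simp
    | false =>
      rw [List.map_singleton, lastDivider_concat_of_undivided, ← ih hm]
      · simp
      · exact by_contra fun h => by simpa using ha.2 (not_undivided_singleton.1 h)

theorem before_append_cons (a : Letter) (β : Bool) (m m' : List (Letter × Bool)) :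
    before a ((m.map Prod.fst).count a + 1) (m ++ (a, β) :: m') = m := by
  induction m with
  | nil => simp [before]
  | cons c m ih =>
    rw [List.cons_append, before, List.map_cons]
    split_ifs with hc
    · simp_all
    · simp_all
    · simpa [List.count_cons_of_ne hc] using ih

theorem restrictor_eq_lastDivider {w : Word} (hw : w.toList = p ++ a :: q) (n : ℕ) :
    restrictor (p.count a + 1) n w a = lastDivider (dividers w.toList (n + 1)) p := by
  obtain ⟨hdecomp, hflatten⟩ := isDecomposition_decomposition w n
  rw [← map_fst_marked, hw, List.map_eq_append_iff] at hflatten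
  obtain ⟨m, m', hm, rfl, hm'⟩ := hflatten
  obtain ⟨⟨b, β⟩, m', rfl, rfl, -⟩ := List.map_eq_cons_iff.1 hm'
  have hmarking := hdecomp.isMarking
  rw [hm, isMarking_append] at hmarking
  rw [restrictor, hm, before_append_cons]
  exact hmarking.1.getLast?_filter

theorem sameSimpMul_iff {u v : Word} : SameSimpMul u v ↔
    ∀ a, min 2 (u.toList.count a) = min 2 (v.toList.count a) := by
  simp only [SameSimpMul, sim, mul, occ, Set.ext_iff, Set.mem_ofPred_eq, ← forall_and]
  refine forall_congr' fun a => ?_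
  omega

theorem profile_dividers_eq_iff {n : ℕ} {u v : Word} :
    profile (dividers u.toList (n + 1)) u.toList = profile (dividers v.toList (n + 1)) v.toList ↔
      SameSimpMul u v ∧ SameRestrictors n u v := by
  rw [profile_eq_iff, sameSimpMul_iff]
  refine and_congr_right fun _ => ⟨fun h a _ i hi hu hv => ?_,
    fun h a p q p' q' hu hv hcount hp => ?_⟩
  · obtain ⟨i, rfl⟩ : ∃ j, i = j + 1 := ⟨i - 1, by omega⟩
    obtain ⟨p, q, hup, rfl⟩ := exists_append_of_lt_count hu
    obtain ⟨p', q', hvp, hcount⟩ := exists_append_of_lt_count hv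
    have hlast := h a p q p' q' hup hvp hcount.symm (by omega)
    rwa [← restrictor_eq_lastDivider hup, ← restrictor_eq_lastDivider hvp, hcount] at hlast
  · have hau : a ∈ con u := List.count_pos_iff.2 (hu ▸ by simp)
    have hrestrictor := h a hau (p.count a + 1) (by omega)
      (by simp [occ, hu]) (by simp [occ, hv, hcount])
    rwa [restrictor_eq_lastDivider hu, hcount, restrictor_eq_lastDivider hv] at hrestrictor

end Decompositions

end MonoidWords

theorem proposition6p12 (u v : MonoidWords.Word) (huv : u ≠ v) :
    (∀ k : ℕ, 1 ≤ k →
      (MonoidWords.HoldsIn (MonoidWords.F.{w} k) (u, v) ↔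
        MonoidWords.SameSimpMul u v ∧ MonoidWords.SameRestrictors (k - 1) u v)) ∧
    (MonoidWords.HoldsIn MonoidWords.K.{w} (u, v) ↔
      MonoidWords.SameSimpMul u v ∧
        ∀ l : ℕ, 1 ≤ l → MonoidWords.SameRestrictors (l - 1) u v) := by
  constructor
  · intro k hk
    obtain ⟨n, rfl⟩ := Nat.exists_eq_add_of_le' hk
    rw [MonoidWords.F, MonoidWords.holdsIn_var_iff, MonoidWords.consequences_Phi_alpha_iff,
      MonoidWords.profile_dividers_eq_iff, Nat.add_sub_cancel]
  · rw [MonoidWords.K, MonoidWords.holdsIn_var_iff, MonoidWords.consequences_Phi_iff]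
    simp only [MonoidWords.profile_dividers_eq_iff]
    exact ⟨fun h => ⟨(h 0).1, fun l _ => (h (l - 1)).2⟩,
      fun h n => ⟨h.1, h.2 (n + 1) n.succ_pos⟩⟩
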